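/- Let $\Omega\subset\mathbb R^n$ be open, let $(X,d,z_0)$ be a pointed complete metric space, and let $f:\Omega\to X$ be Lipschitz continuous. Let $\mathrm{Lip}_{z_0}(X)$ be the space of all real-valued Lipschitz functions on $X$ that vanish at $z_0$, normed by $\mathrm{Lip}(\varphi)=\sup_{x\neq y}|\varphi(x)-\varphi(y)|/d(x,y)$, let $(\mathrm{Lip}_{z_0}(X))^*$ be its dual Banach space, and write $\langle\varphi,w\rangle=w(\varphi)$. Then: (i) There is a map $\nabla^\circ f:\Omega\to\mathcal L(\mathbb R^n;(\mathrm{Lip}_{z_0}(X))^*)$ into the bounded linear operators such that, for all $x\in\Omega$, $\varphi\in\mathrm{Lip}_{z_0}(X)$ and $\nu\in\mathbb R^n$, $$\langle\varphi,\nabla^\circ f(x)\cdot\nu\rangle=\nabla(\varphi\circ f)(x)\cdot\nu\qquad(*)$$ whenever $\varphi\circ f$ is classically differentiable at $x$. (ii) There is a seminorm $\rho$ on $(\mathrm{Lip}_{z_0}(X))^*$ such that, for every map $\nabla^\circ f$ with property $(*)$ and for almost every $x\in\Omega$, $f$ is metrically differentiable at $x$ and its metric differential satisfies $$\mathrm{md}(f,x)(\nu)=\rho(\nabla^\circ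 f(x)\cdot\nu)\quad\text{for all }\nu\in\mathbb R^n .$$ Here $f$ is metrically differentiable at $x$ with metric differential $\mathrm{md}(f,x)$ if $\mathrm{md}(f,x)$ is a seminorm on $\mathbb R^n$ with $d(f(y),f(x))-\mathrm{md}(f,x)(y-x)=o(|y-x|)$ as $y\to x$. Moreover, if $X$ has at least two points, $\rho$ can be taken of the form $\rho(w)=\sup_{k\in\mathbb N}|\langle\varphi_k,w\rangle|$, where $(\varphi_k)_{k\in\mathbb N}$ is an essential gauge sequence for $f(\Omega)$, that is, $\varphi_k\in\mathrm{Lip}_{z_0}(X)$, $\mathrm{Lip}(\varphi_k)=1$ for all $k$, and $d(x,y)=\sup_k|\varphi_k(x)-\varphi_k(y)|$ for all $x,y\in f(\Omega)$. -/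

import Mathlib

open MeasureTheory Topology Asymptotics Filter
open scoped NNReal

noncomputable section

/-- The linear space of all real valued Lipschitz functions on `X` vanishing at `z₀`. -/
def lipSubmodule (X : Type*) [MetricSpace X] (z₀ : X) : Submodule ℝ (X → ℝ) where
  carrier := {φ | (∃ K : ℝ≥0, LipschitzWith K φ) ∧ φ z₀ = 0}
  add_mem' := by
    rintro a b ⟨⟨K, hK⟩, ha⟩ ⟨⟨L, hL⟩, hb⟩
    exact ⟨⟨K + L, hK.add hL⟩, by simp [ha, hb]⟩
  zero_mem' := ⟨⟨0, LipschitzWith.const 0⟩, rfl⟩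
  smul_mem' := by
    rintro c a ⟨⟨K, hK⟩, ha⟩
    refine ⟨⟨‖c‖₊ * K, LipschitzWith.of_dist_le_mul fun x y => ?_⟩, by simp [ha]⟩
    have h := hK.dist_le_mul x y
    simp only [Pi.smul_apply, smul_eq_mul, Real.dist_eq, ← mul_sub, abs_mul, NNReal.coe_mul,
      coe_nnnorm, Real.norm_eq_abs] at h ⊢
    rw [mul_assoc]
    exact mul_le_mul_of_nonneg_left h (abs_nonneg c)

/-- `Lip_{z₀}(X)`. It is a type of its own (not a reducible abbreviation of a subspace of `X → ℝ`),
so that its norm and topology come from the Lipschitz constant and not from pointwise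
convergence. -/
def LipZero (X : Type*) [MetricSpace X] (z₀ : X) : Type _ := lipSubmodule X z₀

namespace LipZero

variable {X : Type*} [MetricSpace X] {z₀ : X}

instance : AddCommGroup (LipZero X z₀) := inferInstanceAs (AddCommGroup (lipSubmodule X z₀))

instance : Module ℝ (LipZero X z₀) := inferInstanceAs (Module ℝ (lipSubmodule X z₀))

instance : FunLike (LipZero X z₀) X ℝ where
  coe φ := φ.1
  coe_injective _ _ h := Subtype.ext h

theorem coe_zero : ⇑(0 : LipZero X z₀) = 0 := rfl

theorem coe_add (φ ψ : LipZero X z₀) : ⇑(φ + ψ) = ⇑φ + ⇑ψ := rfl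

theorem coe_neg (φ : LipZero X z₀) : ⇑(-φ) = -⇑φ := rfl

theorem coe_smul (c : ℝ) (φ : LipZero X z₀) : ⇑(c • φ) = c • ⇑φ := rfl

theorem apply_base (φ : LipZero X z₀) : φ z₀ = 0 := φ.2.2

/-- The Lipschitz constant `Lip(φ) = sup_{x ≠ y} |φ x - φ y| / d(x, y)` (equal to `0` on a
one-point space). -/
def lipConst (φ : LipZero X z₀) : ℝ :=
  sSup {r | ∃ x y : X, x ≠ y ∧ r = |φ x - φ y| / dist x y}

theorem bddAbove (φ : LipZero X z₀) :
    BddAbove {r | ∃ x y : X, x ≠ y ∧ r = |φ x - φ y| / dist x y} := by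
  obtain ⟨K, hK⟩ := φ.2.1
  refine ⟨K, ?_⟩
  rintro r ⟨x, y, hxy, rfl⟩
  rw [div_le_iff₀ (dist_pos.2 hxy)]
  exact hK.dist_le_mul x y

theorem lipConst_nonneg (φ : LipZero X z₀) : 0 ≤ φ.lipConst := by
  apply Real.sSup_nonneg
  rintro r ⟨x, y, -, rfl⟩
  positivity

theorem abs_sub_le (φ : LipZero X z₀) (x y : X) : |φ x - φ y| ≤ φ.lipConst * dist x y := by
  rcases eq_or_ne x y with rfl | hxy
  · simp
  · rw [← div_le_iff₀ (dist_pos.2 hxy)]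
    exact le_csSup φ.bddAbove ⟨x, y, hxy, rfl⟩

theorem lipConst_le_of {φ : LipZero X z₀} {C : ℝ} (hC : 0 ≤ C)
    (h : ∀ x y, |φ x - φ y| ≤ C * dist x y) : φ.lipConst ≤ C := by
  apply Real.sSup_le _ hC
  rintro r ⟨x, y, hxy, rfl⟩
  rw [div_le_iff₀ (dist_pos.2 hxy)]
  exact h x y

/-- `Lip_{z₀}(X)` is normed by the Lipschitz constant. -/
instance : NormedAddCommGroup (LipZero X z₀) :=
  AddGroupNorm.toNormedAddCommGroup
    { toFun := lipConst
      map_zero' := le_antisymm (lipConst_le_of le_rfl fun x y => by simp [coe_zero]) (lipConst_nonneg _)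
      add_le' := fun φ ψ => lipConst_le_of (add_nonneg (lipConst_nonneg _) (lipConst_nonneg _))
        fun x y => by
          have h1 := φ.abs_sub_le x y
          have h2 := ψ.abs_sub_le x y
          have h3 := abs_add_le (φ x - φ y) (ψ x - ψ y)
          have h4 : (φ + ψ) x - (φ + ψ) y = (φ x - φ y) + (ψ x - ψ y) := by
            simp only [coe_add, Pi.add_apply]; ring
          rw [h4, add_mul]
          linarith
      neg' := fun φ => by
        have h : ∀ x y, |(-φ) x - (-φ) y| = |φ x - φ y| := fun x y => by
          simp only [coe_neg, Pi.neg_apply]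
          rw [neg_sub_neg, abs_sub_comm]
        simp only [lipConst, h]
      eq_zero_of_map_eq_zero' := fun φ h => by
        apply DFunLike.coe_injective
        funext x
        have h1 := φ.abs_sub_le x z₀
        have h2 : φ.lipConst = 0 := h
        rw [h2, zero_mul, φ.apply_base, sub_zero] at h1
        simpa [coe_zero] using h1 }

theorem norm_def (φ : LipZero X z₀) : ‖φ‖ = φ.lipConst := rfl

instance : NormedSpace ℝ (LipZero X z₀) where
  norm_smul_le c φ := lipConst_le_of (mul_nonneg (norm_nonneg _) (lipConst_nonneg _)) fun x y => by
    have h1 := φ.abs_sub_le x y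
    rw [norm_def]
    simp only [coe_smul, Pi.smul_apply, smul_eq_mul, ← mul_sub, abs_mul, Real.norm_eq_abs]
    rw [mul_assoc]
    exact mul_le_mul_of_nonneg_left h1 (abs_nonneg c)

end LipZero

/-- The seminorm `σ` on `ℝⁿ` is the metric differential of `f` at `x`:
`d(f y, f x) - σ (y - x) = o(|y - x|)` as `y → x`. -/
def HasMetricDifferentialAt {n : ℕ} {X : Type*} [MetricSpace X]
    (f : EuclideanSpace ℝ (Fin n) → X) (σ : Seminorm ℝ (EuclideanSpace ℝ (Fin n)))
    (x : EuclideanSpace ℝ (Fin n)) : Prop :=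
  (fun y => dist (f y) (f x) - σ (y - x)) =o[𝓝 x] fun y => ‖y - x‖

/-- `D` assigns to each `x ∈ Ω` a bounded linear operator `ℝⁿ → Lip_{z₀}(X)*` such that
`⟨φ, D x ν⟩ = ∇(φ ∘ f)(x) · ν` for every `φ ∈ Lip_{z₀}(X)` and `ν`, whenever `φ ∘ f` is
(classically) differentiable at `x`. The values of `D` outside `Ω` play no role. -/
def IsWeakWeakStarGradient {n : ℕ} {X : Type*} [MetricSpace X] {z₀ : X}
    (Ω : Set (EuclideanSpace ℝ (Fin n))) (f : EuclideanSpace ℝ (Fin n) → X)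
    (D : EuclideanSpace ℝ (Fin n) →
      (EuclideanSpace ℝ (Fin n) →L[ℝ] StrongDual ℝ (LipZero X z₀))) : Prop :=
  ∀ x ∈ Ω, ∀ φ : LipZero X z₀, DifferentiableAt ℝ (fun y => φ (f y)) x →
    ∀ ν, D x ν φ = fderiv ℝ (fun y => φ (f y)) x ν

/-- `φ` is an essential gauge sequence for `E ⊆ X`: `Lip(φ k) = 1` for all `k` and
`d(x, y) = sup_k |φ k x - φ k y|` for all `x, y ∈ E`. -/
def IsEssentialGaugeSequence {X : Type*} [MetricSpace X] {z₀ : X}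
    (φ : ℕ → LipZero X z₀) (E : Set X) : Prop :=
  (∀ k, (φ k).lipConst = 1) ∧
    ∀ x ∈ E, ∀ y ∈ E, IsLUB (Set.range fun k => |φ k x - φ k y|) (dist x y)

end

/-! (i) For fixed `x` and direction, the derivative of `φ ∘ f` is linear and bounded in `φ` on the
subspace where it exists; Hahn–Banach extends it. (ii) Gauge functions are normalized distances to
points `p k` dense in the image. Extend each `φ k ∘ f` to a Lipschitz `u k`, differentiable a.e. by
Rademacher; at such points `D x ν` takes forced values on the `φ k`, whichever `D` is chosen. Since
`dist (f y) (f x)` is the supremum of the `|u k y - u k x|`, the lower bound needs only one nearly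
optimal `k`. The upper bound must be uniform in `k`: on a line every increment is at most the
integral of the supremum of the derivatives, and Lebesgue differentiation of that single function
gives the uniformity (`ae_abs_sub_le_mul_iSup_abs_deriv`). Fubini carries this to `ℝⁿ`, and
compactness of the sphere passes from countably many directions to all (`isLittleO_of_isLUB`). -/

/-- The supremum of the absolute values of a bounded sequence of evaluations, as a seminorm on the
dual space. -/
noncomputable def supEvalSeminorm {V : Type*} [NormedAddCommGroup V] [NormedSpace ℝ V]
    (φ : ℕ → V) (hφ : ∀ w : StrongDual ℝ V, BddAbove (Set.range fun k => |w (φ k)|)) :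
    Seminorm ℝ (StrongDual ℝ V) :=
  Seminorm.of (fun w => ⨆ k, |w (φ k)|)
    (fun v w => ciSup_le fun k => (abs_add_le (v (φ k)) (w (φ k))).trans
      (add_le_add (le_ciSup (hφ v) k) (le_ciSup (hφ w) k)))
    (fun c w => by
      simp only [_root_.smul_apply, smul_eq_mul, abs_mul, Real.norm_eq_abs]
      rw [Real.mul_iSup_of_nonneg (abs_nonneg c)])

theorem isLUB_supEvalSeminorm {V : Type*} [NormedAddCommGroup V] [NormedSpace ℝ V]
    (φ : ℕ → V) (hφ : ∀ w : StrongDual ℝ V, BddAbove (Set.range fun k => |w (φ k)|))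
    (w : StrongDual ℝ V) :
    IsLUB (Set.range fun k => |w (φ k)|) (supEvalSeminorm φ hφ w) :=
  isLUB_ciSup (hφ w)

/-! ### Uniform increment bounds along lines -/

/-- At almost every point, the increments of a uniformly Lipschitz sequence of functions of one real
variable are controlled, uniformly in the sequence, by the supremum of the derivatives. -/
theorem ae_abs_sub_le_mul_iSup_abs_deriv {u : ℕ → ℝ → ℝ} {K : ℝ≥0}
    (hu : ∀ k, LipschitzWith K (u k)) :
    ∀ᵐ t : ℝ, ∀ ε > 0, ∃ η > 0, ∀ s : ℝ, |s| < η → ∀ k,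
      |u k (t + s) - u k t| ≤ |s| * ((⨆ k, |deriv (u k) t|) + ε) := by
  set m : ℝ → ℝ := fun t => ⨆ k, |deriv (u k) t| with hm
  have hd : ∀ k t, |deriv (u k) t| ≤ K := fun k t => norm_deriv_le_of_lipschitz (hu k)
  have hbdd : ∀ t, BddAbove (Set.range fun k => |deriv (u k) t|) := fun t =>
    ⟨K, by rintro _ ⟨k, rfl⟩; exact hd k t⟩
  have hmm : Measurable m := Measurable.iSup fun k => (measurable_deriv (u k)).abs
  have hm0 : ∀ t, 0 ≤ m t := fun t => Real.iSup_nonneg fun k => abs_nonneg _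
  have hmK : ∀ t, ‖m t‖ ≤ K := fun t => by
    rw [Real.norm_of_nonneg (hm0 t)]
    exact ciSup_le fun k => hd k t
  have hml : LocallyIntegrable m volume :=
    (memLp_top_of_bound hmm.aestronglyMeasurable K (.of_forall hmK)).locallyIntegrable le_top
  filter_upwards [_root_.LocallyIntegrable.ae_hasDerivAt_integral hml] with t ht ε hε
  have h1 := (hasDerivAt_iff_isLittleO.1 (ht t)).def hε
  obtain ⟨η, hη, h2⟩ := Metric.eventually_nhds_iff.1 h1
  refine ⟨η, hη, fun s hs k => ?_⟩
  have h3 := h2 (y := t + s) (by simpa [Real.dist_eq] using hs)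
  simp only [intervalIntegral.integral_same, sub_zero, add_sub_cancel_left, smul_eq_mul,
    Real.norm_eq_abs] at h3
  -- Lipschitz functions are absolutely continuous, so the increment is the integral of the
  -- derivative; the bound no longer sees `k`.
  have h4 : |u k (t + s) - u k t| ≤ |∫ r in t..(t + s), m r| := by
    rw [← ((hu k).lipschitzOnWith.absolutelyContinuousOnInterval).integral_deriv_eq_sub]
    rw [← Real.norm_eq_abs (∫ r in t..(t + s), deriv (u k) r)]
    refine intervalIntegral.norm_integral_le_abs_of_norm_le (.of_forall fun r => ?_) ?_
    · exact le_ciSup (hbdd r) k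
    · exact intervalIntegrable_iff.mpr <|
        (hml.integrableOn_isCompact isCompact_uIcc).mono_set Set.uIoc_subset_uIcc
  have h5 := abs_sub_abs_le_abs_sub (∫ r in t..(t + s), m r) (s * m t)
  rw [abs_mul, abs_of_nonneg (hm0 t)] at h5
  rw [mul_add]
  linarith

/-- An inequality between continuous functions on a symmetric open interval may be checked at
rational points. -/
theorem forall_abs_lt_of_forall_rat {a b : ℝ → ℝ} (ha : Continuous a) (hb : Continuous b) {η : ℝ}
    (h : ∀ q : ℚ, |(q : ℝ)| < η → a q ≤ b q) (t : ℝ) (ht : |t| < η) : a t ≤ b t := by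
  have ho : IsOpen {t : ℝ | |t| < η} := isOpen_lt continuous_abs continuous_const
  have hsub : {t : ℝ | |t| < η} ∩ Set.range ((↑) : ℚ → ℝ) ⊆ {t | a t ≤ b t} := by
    rintro _ ⟨hq, q, rfl⟩
    exact h q hq
  exact closure_minimal hsub (isClosed_le ha hb)
    ((Rat.denseRange_cast (𝕜 := ℝ)).open_subset_closure_inter ho ht)

/-- At almost every point, the increments in a fixed direction of a uniformly Lipschitz sequence of
functions are controlled, uniformly in the sequence, by the supremum of the line derivatives. -/
theorem ae_abs_sub_le_mul_iSup_abs_lineDeriv {E : Type*} [NormedAddCommGroup E] [NormedSpace ℝ E]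
    [FiniteDimensional ℝ E] [MeasurableSpace E] [BorelSpace E] (μ : Measure E)
    [μ.IsAddHaarMeasure] {u : ℕ → E → ℝ} {K : ℝ≥0} (hu : ∀ k, LipschitzWith K (u k)) (v : E) :
    ∀ᵐ x ∂μ, ∀ ε > 0, ∃ η > 0, ∀ s : ℝ, |s| < η → ∀ k,
      |u k (x + s • v) - u k x| ≤ |s| * ((⨆ k, |lineDeriv ℝ (u k) x v|) + ε) := by
  have hc : ∀ k, Continuous (u k) := fun k => (hu k).continuous
  -- Countable quantifiers (`1 / (j + 1)`, `1 / (i + 1)`, rational steps) make the good set Borel,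
  -- as Fubini requires.
  set S : Set E := {x | ∀ j : ℕ, ∃ i : ℕ, ∀ q : ℚ, |(q : ℝ)| < 1 / ((i : ℝ) + 1) → ∀ k,
    |u k (x + (q : ℝ) • v) - u k x| ≤
      |(q : ℝ)| * ((⨆ k, |lineDeriv ℝ (u k) x v|) + 1 / ((j : ℝ) + 1))} with hS
  have hSm : MeasurableSet S := by
    simp only [hS, Set.ofPred_forall, Set.ofPred_exists]
    refine .iInter fun j => .iUnion fun i => .iInter fun q => .iInter fun _ => .iInter fun k => ?_
    refine measurableSet_le ?_ ?_
    · have := hc k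
      exact Continuous.measurable (by fun_prop)
    · exact ((Measurable.iSup fun k => (measurable_lineDeriv (hc k)).abs).add_const _).const_mul _
  have key : ∀ᵐ x ∂μ, x ∈ S := by
    let L : ℝ →L[ℝ] E := ContinuousLinearMap.smulRight (1 : ℝ →L[ℝ] ℝ) v
    -- Fubini: it suffices that almost every point of each line in direction `v` lies in `S`.
    refine ae_mem_of_ae_add_linearMap_mem L.toLinearMap volume μ hSm fun x => ?_
    have hl : ∀ k, LipschitzWith (K * (0 + ‖L‖₊)) (fun t => u k (x + t • v)) := fun k =>
      (hu k).comp ((LipschitzWith.const x).add L.lipschitz)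
    filter_upwards [ae_abs_sub_le_mul_iSup_abs_deriv hl] with t ht j
    obtain ⟨η, hη, h⟩ := ht (1 / ((j : ℝ) + 1)) (by positivity)
    obtain ⟨i, hi⟩ := exists_nat_one_div_lt hη
    refine ⟨i, fun q hq k => ?_⟩
    have hline : ∀ k, lineDeriv ℝ (u k) (x + t • v) v = deriv (fun t => u k (x + t • v)) t := by
      intro k
      have := deriv_comp_const_add (f := fun t => u k (x + t • v)) t 0
      rw [add_zero] at this
      rw [← this, lineDeriv]
      simp only [add_smul, add_assoc]
    have h1 := h q (hq.trans hi) k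
    simp only [← hline, add_smul, ← add_assoc] at h1
    exact h1
  filter_upwards [key] with x hx ε hε
  obtain ⟨j, hj⟩ := exists_nat_one_div_lt hε
  obtain ⟨i, hi⟩ := hx j
  refine ⟨1 / ((i : ℝ) + 1), by positivity, fun s hs k => ?_⟩
  have h1 := forall_abs_lt_of_forall_rat
    (a := fun s => |u k (x + s • v) - u k x|)
    (b := fun s => |s| * ((⨆ k, |lineDeriv ℝ (u k) x v|) + 1 / ((j : ℝ) + 1)))
    (by have := hc k; fun_prop) (by fun_prop) (fun q hq => hi q hq k) s hs
  exact h1.trans (by gcongr)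

/-! ### From directions to a first order expansion -/

/-- Directional control of the increments in a dense set of directions, together with
differentiability of every function of the sequence, gives a first order expansion of the supremum
of the increments. -/
theorem isLittleO_of_isLUB {E : Type*} [NormedAddCommGroup E] [NormedSpace ℝ E]
    [FiniteDimensional ℝ E] {u : ℕ → E → ℝ} {K : ℝ≥0} (hu : ∀ k, LipschitzWith K (u k)) {x : E}
    (hd : ∀ k, DifferentiableAt ℝ (u k) x) {σ : Seminorm ℝ E}
    (hσ : ∀ v, IsLUB (Set.range fun k => |fderiv ℝ (u k) x v|) (σ v))
    {δ : E → ℝ} (hδ : ∀ᶠ y in 𝓝 x, IsLUB (Set.range fun k => |u k y - u k x|) (δ y))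
    {d : ℕ → E} (hdense : DenseRange d)
    (hdir : ∀ i, ∀ ε > 0, ∃ η > 0, ∀ s : ℝ, |s| < η → ∀ k,
      |u k (x + s • d i) - u k x| ≤ |s| * (σ (d i) + ε)) :
    (fun y => δ y - σ (y - x)) =o[𝓝 x] fun y => ‖y - x‖ := by
  have hσK : ∀ v, σ v ≤ K * ‖v‖ := fun v => (hσ v).2 <| by
    rintro _ ⟨k, rfl⟩
    exact (fderiv ℝ (u k) x).le_of_opNorm_le (norm_fderiv_le_of_lipschitz ℝ (hu k)) v
  have hσl : ∀ v w, σ v ≤ σ w + K * ‖v - w‖ := fun v w => by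
    have h := map_add_le_add σ w (v - w)
    rw [add_sub_cancel] at h
    exact h.trans (add_le_add_right (hσK _) _)
  have local_bound : ∀ i, ∀ ε > 0, ∀ᶠ y in 𝓝 x,
      ‖(y - x) - ‖y - x‖ • d i‖ ≤ ε * ‖y - x‖ →
        |δ y - σ (y - x)| ≤ (2 + 2 * K) * ε * ‖y - x‖ := by
    intro i ε hε
    obtain ⟨η, hη, hup⟩ := hdir i ε hε
    obtain ⟨k, hk⟩ : ∃ k, σ (d i) - ε < |fderiv ℝ (u k) x (d i)| := by
      obtain ⟨_, ⟨k, rfl⟩, hk, -⟩ := (hσ (d i)).exists_between (sub_lt_self _ hε)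
      exact ⟨k, hk⟩
    have hnear : ∀ᶠ y in 𝓝 x, ‖y - x‖ < η := by
      filter_upwards [Metric.ball_mem_nhds x hη] with y hy
      simpa [dist_eq_norm] using hy
    filter_upwards [hδ, hnear, (hasFDerivAt_iff_isLittleO.1 (hd k).hasFDerivAt).def hε]
      with y hy hyη hyk hdy
    set s := ‖y - x‖ with hs
    have hs0 : 0 ≤ s := norm_nonneg _
    have hKs : K * ‖(y - x) - s • d i‖ ≤ K * (ε * s) := by gcongr
    have hKs' : K * ‖s • d i - (y - x)‖ ≤ K * (ε * s) := by rwa [norm_sub_rev]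
    have hsσ : σ (s • d i) = s * σ (d i) := by
      rw [map_smul_eq_mul, Real.norm_of_nonneg hs0]
    have h1 := hσl (s • d i) (y - x)
    have h2 := hσl (y - x) (s • d i)
    rw [hsσ] at h1 h2
    -- Replacing `y - x` by `s • d i` costs `K * ε * s` each time, twice per bound. The lower bound
    -- also loses `ε * s` in the choice of `k` and in differentiability, whence `2 + 2 * K`.
    rw [abs_le]
    constructor
    · have h3 : |u k y - u k x| ≤ δ y := hy.1 ⟨k, rfl⟩
      have h4 : s * σ (d i) ≤ s * |fderiv ℝ (u k) x (d i)| + s * ε := by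
        rw [← mul_add]
        exact mul_le_mul_of_nonneg_left (by linarith) hs0
      have h5 : s * |fderiv ℝ (u k) x (d i)| = |fderiv ℝ (u k) x (s • d i)| := by
        rw [map_smul, smul_eq_mul, abs_mul, abs_of_nonneg hs0]
      have h6 : |fderiv ℝ (u k) x (s • d i - (y - x))| ≤ K * ‖s • d i - (y - x)‖ :=
        (fderiv ℝ (u k) x).le_of_opNorm_le (norm_fderiv_le_of_lipschitz ℝ (hu k)) _
      rw [map_sub] at h6
      have h7 := abs_sub_abs_le_abs_sub (fderiv ℝ (u k) x (s • d i)) (fderiv ℝ (u k) x (y - x))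
      rw [Real.norm_eq_abs] at hyk
      have h8 := abs_sub_abs_le_abs_sub (fderiv ℝ (u k) x (y - x)) (u k y - u k x)
      rw [abs_sub_comm (fderiv ℝ (u k) x (y - x))] at h8
      linarith
    · have h3 : δ y ≤ s * (σ (d i) + ε) + K * (ε * s) := hy.2 <| by
        rintro _ ⟨l, rfl⟩
        have h4 := hup s (by rwa [abs_of_nonneg hs0]) l
        rw [abs_of_nonneg hs0] at h4
        have h5 := (hu l).dist_le_mul y (x + s • d i)
        rw [Real.dist_eq, dist_eq_norm, ← sub_sub] at h5
        have h6 := abs_sub_le (u l y) (u l (x + s • d i)) (u l x)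
        linarith
      have h9 : 0 ≤ ε * s := by positivity
      linarith
  refine isLittleO_iff.2 fun c hc => ?_
  set ε : ℝ := c / (2 + 2 * K) with hε
  have hK : (0 : ℝ) < 2 + 2 * K := by positivity
  have hε0 : 0 < ε := by positivity
  -- Finitely many directions suffice for this `ε`, so their neighbourhoods of `x` can be
  -- intersected.
  obtain ⟨I, hI⟩ := (isCompact_sphere (0 : E) 1).elim_finite_subcover
    (fun i => Metric.ball (d i) ε) (fun i => Metric.isOpen_ball) (fun v _ => by
      obtain ⟨i, hi⟩ := hdense.exists_dist_lt v hε0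
      exact Set.mem_iUnion.2 ⟨i, hi⟩)
  have hall : ∀ᶠ y in 𝓝 x, ∀ i ∈ I, ‖(y - x) - ‖y - x‖ • d i‖ ≤ ε * ‖y - x‖ →
        |δ y - σ (y - x)| ≤ (2 + 2 * K) * ε * ‖y - x‖ :=
    (Filter.eventually_all_finset I).2 fun i _ => local_bound i ε hε0
  filter_upwards [hall, hδ] with y hy hyδ
  rw [Real.norm_eq_abs, norm_norm]
  rcases eq_or_ne y x with rfl | hne
  · have h0 : δ y = 0 := hyδ.unique (by simp)
    simp [h0]
  · have hs : 0 < ‖y - x‖ := norm_pos_iff.2 (sub_ne_zero.2 hne)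
    have hmem : ‖y - x‖⁻¹ • (y - x) ∈ Metric.sphere (0 : E) 1 := by
      simp [norm_smul, inv_mul_cancel₀ hs.ne']
    obtain ⟨i, hi, hb⟩ := Set.mem_iUnion₂.1 (hI hmem)
    rw [Metric.mem_ball, dist_eq_norm] at hb
    have h := hy i hi <| by
      have h1 : (y - x) - ‖y - x‖ • d i = ‖y - x‖ • (‖y - x‖⁻¹ • (y - x) - d i) := by
        rw [smul_sub, smul_inv_smul₀ hs.ne']
      rw [h1, norm_smul, norm_norm, mul_comm]
      gcongr
    rwa [hε, mul_div_cancel₀ _ hK.ne'] at h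

/-! ### Gauge functions and the gradient -/

namespace LipZero

variable {X : Type*} [MetricSpace X] {z₀ : X}

/-- The distance function to `p`, normalized to vanish at the base point. -/
def distTo (z₀ p : X) : LipZero X z₀ :=
  ⟨fun x => dist x p - dist z₀ p, ⟨1, LipschitzWith.of_dist_le_mul fun x y => by
    simpa [Real.dist_eq] using abs_dist_sub_le x y p⟩, sub_self _⟩

theorem distTo_sub_distTo (p x y : X) : distTo z₀ p x - distTo z₀ p y = dist x p - dist y p :=
  sub_sub_sub_cancel_right _ _ _

theorem norm_distTo_le (p : X) : ‖distTo z₀ p‖ ≤ 1 :=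
  lipConst_le_of zero_le_one fun x y => by
    rw [distTo_sub_distTo, one_mul]
    exact abs_dist_sub_le x y p

theorem lipConst_distTo [Nontrivial X] (p : X) : (distTo z₀ p).lipConst = 1 := by
  refine le_antisymm (norm_distTo_le p) ?_
  obtain ⟨y, hy⟩ := exists_ne p
  have h := (distTo z₀ p).abs_sub_le y p
  rw [distTo_sub_distTo, dist_self, sub_zero, abs_of_nonneg dist_nonneg] at h
  exact le_of_mul_le_mul_right (by rwa [one_mul]) (dist_pos.2 hy)

/-- If `p k` is close to `x`, then `dist y (p k) - dist x (p k)` is close to `dist x y`; hence only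
`x` need lie in the closure. -/
theorem isLUB_distTo {p : ℕ → X} {x : X} (hx : x ∈ closure (Set.range p)) (y : X) :
    IsLUB (Set.range fun k => |distTo z₀ (p k) x - distTo z₀ (p k) y|) (dist x y) := by
  refine ⟨?_, fun b hb => le_of_forall_pos_le_add fun ε hε => ?_⟩
  · rintro _ ⟨k, rfl⟩
    simp only [distTo_sub_distTo]
    exact abs_dist_sub_le x y (p k)
  · obtain ⟨_, ⟨k, rfl⟩, hk⟩ := Metric.mem_closure_iff.1 hx (ε / 2) (by positivity)
    have h1 := hb ⟨k, rfl⟩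
    simp only [distTo_sub_distTo] at h1
    have h2 := neg_abs_le (dist x (p k) - dist y (p k))
    have h3 := dist_triangle_right x y (p k)
    linarith

theorem lipschitzWith (φ : LipZero X z₀) : LipschitzWith ‖φ‖₊ φ :=
  LipschitzWith.of_dist_le_mul fun x y => φ.abs_sub_le x y

/-- The derivative at `x` of `φ ∘ f` in the direction `v`, defined on the functions `φ` for which
`φ ∘ f` is differentiable at `x`, extends to a bounded functional. -/
theorem exists_strongDual_eq_fderiv {E : Type*} [NormedAddCommGroup E] [NormedSpace ℝ E]
    {f : E → X} {K : ℝ≥0} {s : Set E} (hf : LipschitzOnWith K f s) {x : E} (hs : s ∈ 𝓝 x) (v : E) :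
    ∃ g : StrongDual ℝ (LipZero X z₀), ∀ φ : LipZero X z₀,
      DifferentiableAt ℝ (fun y => φ (f y)) x → g φ = fderiv ℝ (fun y => φ (f y)) x v := by
  let P : Submodule ℝ (LipZero X z₀) :=
    { carrier := {φ | DifferentiableAt ℝ (fun y => φ (f y)) x}
      add_mem' := fun {a b} ha hb => DifferentiableAt.add ha hb
      zero_mem' := differentiableAt_const (0 : ℝ)
      smul_mem' := fun c a ha => DifferentiableAt.const_smul ha c }
  let T : P →ₗ[ℝ] ℝ :=
    { toFun := fun φ => fderiv ℝ (fun y => φ.1 (f y)) x v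
      map_add' := fun a b =>
        congrArg (fun L : E →L[ℝ] ℝ => L v) (fderiv_add a.2 b.2)
      map_smul' := fun c a =>
        congrArg (fun L : E →L[ℝ] ℝ => L v) (fderiv_const_smul a.2 c) }
  have hT : ∀ φ : P, ‖T φ‖ ≤ (K * ‖v‖) * ‖φ‖ := fun φ => by
    have h := (fderiv ℝ (fun y => φ.1 (f y)) x).le_of_opNorm_le
      (norm_fderiv_le_of_lipschitzOn ℝ hs (φ.1.lipschitzWith.comp_lipschitzOnWith hf)) v
    refine h.trans (le_of_eq ?_)
    rw [NNReal.coe_mul, coe_nnnorm, Submodule.coe_norm]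
    ring
  obtain ⟨g, hg, -⟩ := exists_extension_norm_eq P (T.mkContinuous _ hT)
  exact ⟨g, fun φ hφ => hg ⟨φ, hφ⟩⟩

end LipZero

/-- Separate extensions for each `ν` need not be linear in `ν`, so only the basis directions are
extended and then combined by coordinates. -/
theorem exists_isWeakWeakStarGradient {n : ℕ} {Ω : Set (EuclideanSpace ℝ (Fin n))} (hΩ : IsOpen Ω)
    {X : Type*} [MetricSpace X] (z₀ : X) {f : EuclideanSpace ℝ (Fin n) → X} {K : ℝ≥0}
    (hf : LipschitzOnWith K f Ω) :
    ∃ D : EuclideanSpace ℝ (Fin n) →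
        (EuclideanSpace ℝ (Fin n) →L[ℝ] StrongDual ℝ (LipZero X z₀)),
      IsWeakWeakStarGradient Ω f D := by
  have h : ∀ x, ∃ L : EuclideanSpace ℝ (Fin n) →L[ℝ] StrongDual ℝ (LipZero X z₀), x ∈ Ω →
      ∀ φ : LipZero X z₀, DifferentiableAt ℝ (fun y => φ (f y)) x →
        ∀ ν, L ν φ = fderiv ℝ (fun y => φ (f y)) x ν := by
    intro x
    by_cases hx : x ∈ Ω
    · choose g hg using fun i => LipZero.exists_strongDual_eq_fderiv (z₀ := z₀) hf
        (hΩ.mem_nhds hx) (EuclideanSpace.single i (1 : ℝ))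
      refine ⟨∑ i, (EuclideanSpace.proj i : EuclideanSpace ℝ (Fin n) →L[ℝ] ℝ).smulRight (g i),
        fun _ φ hφ ν => ?_⟩
      have hν : ν = ∑ i, ν i • EuclideanSpace.single i (1 : ℝ) := by
        simpa using ((EuclideanSpace.basisFun (Fin n) ℝ).sum_repr ν).symm
      conv_rhs => rw [hν, map_sum]
      simp [hg _ φ hφ]
    · exact ⟨0, fun h => absurd h hx⟩
  choose D hD using h
  exact ⟨D, fun x hx => hD x hx⟩

/-- The metric differential of a Lipschitz map is, almost everywhere, the seminorm obtained from a
weak weak-star gradient by testing with an essential gauge sequence. -/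
theorem ae_hasMetricDifferentialAt {n : ℕ} {Ω : Set (EuclideanSpace ℝ (Fin n))} (hΩ : IsOpen Ω)
    {X : Type*} [MetricSpace X] {z₀ : X} {f : EuclideanSpace ℝ (Fin n) → X} {K : ℝ≥0}
    (hf : LipschitzOnWith K f Ω) {φ : ℕ → LipZero X z₀} (hφ : ∀ k, ‖φ k‖ ≤ 1)
    (hdist : ∀ x ∈ f '' Ω, ∀ y ∈ f '' Ω, IsLUB (Set.range fun k => |φ k x - φ k y|) (dist x y))
    {ρ : Seminorm ℝ (StrongDual ℝ (LipZero X z₀))}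
    (hρ : ∀ w, IsLUB (Set.range fun k => |w (φ k)|) (ρ w))
    {D : EuclideanSpace ℝ (Fin n) →
      (EuclideanSpace ℝ (Fin n) →L[ℝ] StrongDual ℝ (LipZero X z₀))}
    (hD : IsWeakWeakStarGradient Ω f D) :
    ∀ᵐ x ∂volume.restrict Ω, HasMetricDifferentialAt f (ρ.comp (D x).toLinearMap) x := by
  have hlip : ∀ k, LipschitzOnWith K (fun y => φ k (f y)) Ω := fun k => by
    have h := ((φ k).lipschitzWith.weaken (K' := 1) (hφ k)).comp_lipschitzOnWith hf
    rwa [one_mul] at h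
  -- Global extensions let the line argument ignore the shape of `Ω`; near `x ∈ Ω` nothing changes.
  choose u hu huf using fun k => (hlip k).extend_real
  obtain ⟨d, hd⟩ := TopologicalSpace.exists_dense_seq (EuclideanSpace ℝ (Fin n))
  rw [ae_restrict_iff' hΩ.measurableSet]
  filter_upwards [ae_all_iff.2 fun k => (hu k).ae_differentiableAt (μ := volume),
    ae_all_iff.2 fun i => ae_abs_sub_le_mul_iSup_abs_lineDeriv volume hu (d i)] with x hdiff hdir hx
  have heq : ∀ k, u k =ᶠ[𝓝 x] fun y => φ k (f y) := fun k => by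
    filter_upwards [hΩ.mem_nhds hx] with y hy using (huf k hy).symm
  have hσ : ∀ v, IsLUB (Set.range fun k => |fderiv ℝ (u k) x v|)
      (ρ.comp (D x).toLinearMap v) := fun v => by
    have h : ∀ k, fderiv ℝ (u k) x v = D x v (φ k) := fun k => by
      rw [(heq k).fderiv_eq, hD x hx (φ k) ((heq k).differentiableAt_iff.1 (hdiff k))]
    simp only [h]
    exact hρ (D x v)
  refine isLittleO_of_isLUB hu hdiff hσ ?_ hd fun i => ?_
  · filter_upwards [hΩ.mem_nhds hx] with y hy
    simp only [← huf _ hy, ← huf _ hx]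
    exact hdist _ ⟨y, hy, rfl⟩ _ ⟨x, hx, rfl⟩
  · have h := hdir i
    simp only [(hdiff _).lineDeriv_eq_fderiv] at h
    rwa [show (⨆ k, |fderiv ℝ (u k) x (d i)|) = _ from (hσ (d i)).csSup_eq
      (Set.range_nonempty _)] at h

theorem theorem1 (n : ℕ) (Ω : Set (EuclideanSpace ℝ (Fin n))) (hΩ : IsOpen Ω)
    {X : Type*} [MetricSpace X] [CompleteSpace X] (z₀ : X)
    (f : EuclideanSpace ℝ (Fin n) → X) (hf : ∃ K : ℝ≥0, LipschitzOnWith K f Ω) :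
    (∃ D : EuclideanSpace ℝ (Fin n) →
        (EuclideanSpace ℝ (Fin n) →L[ℝ] StrongDual ℝ (LipZero X z₀)),
      IsWeakWeakStarGradient Ω f D) ∧
    ∃ ρ : Seminorm ℝ (StrongDual ℝ (LipZero X z₀)),
      (Nontrivial X → ∃ φ : ℕ → LipZero X z₀, IsEssentialGaugeSequence φ (f '' Ω) ∧
        ∀ w, IsLUB (Set.range fun k => |w (φ k)|) (ρ w)) ∧
      ∀ D : EuclideanSpace ℝ (Fin n) →
          (EuclideanSpace ℝ (Fin n) →L[ℝ] StrongDual ℝ (LipZero X z₀)),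
        IsWeakWeakStarGradient Ω f D →
        ∀ᵐ x ∂volume.restrict Ω, ∃ σ : Seminorm ℝ (EuclideanSpace ℝ (Fin n)),
          HasMetricDifferentialAt f σ x ∧ ∀ ν, σ ν = ρ (D x ν) := by
  obtain ⟨K, hK⟩ := hf
  refine ⟨exists_isWeakWeakStarGradient hΩ z₀ hK, ?_⟩
  -- Adding `z₀` keeps the set nonempty, so a sequence exists even when `Ω` is empty.
  obtain ⟨p, hp⟩ : ∃ p : ℕ → X, insert z₀ (f '' Ω) ⊆ closure (Set.range p) := by
    have hsep : TopologicalSpace.IsSeparable (insert z₀ (f '' Ω)) := by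
      rw [Set.insert_eq]
      exact (Set.finite_singleton z₀).isSeparable.union
        (hK.continuousOn.isSeparable_image
          (TopologicalSpace.IsSeparable.of_separableSpace Ω))
    obtain ⟨c, hc, hsub⟩ := hsep
    have hne : c.Nonempty := closure_nonempty_iff.1 ⟨z₀, hsub (Set.mem_insert _ _)⟩
    obtain ⟨p, rfl⟩ := hc.exists_eq_range hne
    exact ⟨p, hsub⟩
  have hdist : ∀ x ∈ f '' Ω, ∀ y ∈ f '' Ω,
      IsLUB (Set.range fun k => |LipZero.distTo z₀ (p k) x - LipZero.distTo z₀ (p k) y|)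
        (dist x y) :=
    fun x hx y _ => LipZero.isLUB_distTo (hp (Set.mem_insert_of_mem _ hx)) y
  have hbdd : ∀ w : StrongDual ℝ (LipZero X z₀),
      BddAbove (Set.range fun k => |w (LipZero.distTo z₀ (p k))|) := fun w => by
    refine ⟨‖w‖, ?_⟩
    rintro _ ⟨k, rfl⟩
    exact w.unit_le_opNorm _ (LipZero.norm_distTo_le _)
  have hρ := isLUB_supEvalSeminorm _ hbdd
  refine ⟨supEvalSeminorm _ hbdd, fun _ => ⟨_, ⟨fun k => LipZero.lipConst_distTo _, hdist⟩, hρ⟩,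
    fun D hD => ?_⟩
  filter_upwards [ae_hasMetricDifferentialAt hΩ hK (fun k => LipZero.norm_distTo_le _) hdist hρ hD]
    with x hx
  exact ⟨_, hx, fun ν => rfl⟩
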